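/- Consider the system $x_{t+1}=f(x_t,u_t,w_t)$, $t\in\{0,\dots,T-1\}$, with states in $\mathbb R^n$, controls in a nonempty convex set $U\subseteq\mathbb R^m$, and independent, identically distributed disturbances $w_t\in\mathbb R^l$. Let $r:\mathbb R^n\times\mathbb R^m\to\mathbb R$ and $q:\mathbb R^n\to\mathbb R$ be the stage and terminal costs ($f,r,q$ measurable), let $A\subset\mathbb R^n$ be nonempty, convex and compact, and let $\alpha\in(0,1)$, $\delta\ge 0$. A strategy $\pi=(\pi_0,\dots,\pi_{T-1})$ consists of stochastic kernels $\pi_t$ from the histories $(x_0,w_0,\dots,x_{t-1},w_{t-1},x_t)$ to $U$. Let $\mathcal F_{t-1}$ be the information available just before $w_t$ is realized (it contains $x_t$ and $u_t$), and $$\mathrm{CVaR}_\alpha[X\mid\mathcal F]:=\min_{Z\in L^2(\mathcal F)} Z+\mathbb E\Big[\tfrac{(X-Z)^+}{1-\alpha}\,\Big|\,\mathcal F\Big].$$ Define, for $0\le t\le T$, the value function $$v_t(x):=\inf_{\pi}\ \mathbb E^\pi\Big[\sum_{s=t}^{T-1}r(x_s,u_s)+q(x_T)\,\Big|\,x_t=x\Big]\quad\text{s.t.}\quad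 \mathrm{CVaR}^\pi_\alpha[\mathrm{dist}(x_{s+1},A)\mid\mathcal F_{s-1}]\le\delta\ \text{ a.s., } s=t,\dots,T-1,$$ where $\mathrm{dist}(x,A)=\inf_{y\in A}\|x-y\|$ with the Euclidean norm; the infimum over the empty set is $+\infty$, and an expectation or sum with positive part $+\infty$ is $+\infty$. **Theorem (Bellman equation II).** Suppose that $w_t$ is uniformly distributed on $w^{(1)},\dots,w^{(N)}\in\mathbb R^l$, $N\ge 1$. Then, for all functions $v_t:\mathbb R^n\to[-\infty,\infty]$ and all $t\in\{0,\dots,T-1\}$ and $x\in\mathbb R^n$, the Bellman equation $$v_t(x)=\inf_{u\in U,\,z\in\mathbb R}\ r(x,u)+\mathbb E[v_{t+1}(f(x,u,w_t))]\quad\text{s.t.}\quad \mathbb E\Big[z+\frac{(\mathrm{dist}(f(x,u,w_t),A)-z)^+}{1-\alpha}\Big]\le\delta$$ is equivalent to $$v_t(x)=\inf_{u\in U,\,y\in A^N,\,z\in\mathbb R}\ r(x,u)+\frac1N\sum_{i=1}^N v_{t+1}(f(x,u,w^{(i)}))\quad\text{s.t.}\quad z+\frac{\sum_{i=1}^N\big(\|f(x,u,w^{(i)})-y^{(i)}\|-z\big)^+}{N(1-\alpha)}\le\delta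 .$$ In particular, the value function $v_t$ defined above satisfies the second equation for all $t\in\{0,\dots,T-1\}$ and $x\in\mathbb R^n$, with $v_T=q$. -/

import Mathlib

open MeasureTheory ProbabilityTheory
open scoped ENNReal

noncomputable section

/-- The Euclidean space `ℝ^d`. -/
abbrev Euc (d : ℕ) : Type := EuclideanSpace ℝ (Fin d)

/-- The expectation `E[g⁺] - E[g⁻]` of an extended-real-valued function. The value `+∞` stands for
infeasibility of a minimization problem, so `E[g] = +∞` as soon as `E[g⁺] = +∞`. -/
def extExpect {Ω : Type*} [MeasurableSpace Ω] (μ : Measure Ω) (g : Ω → EReal) : EReal :=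
  open Classical in
  if ∫⁻ ω, (g ω).toENNReal ∂μ = ⊤ then ⊤
  else ((∫⁻ ω, (g ω).toENNReal ∂μ : ℝ≥0∞) : EReal) - ((∫⁻ ω, (-(g ω)).toENNReal ∂μ : ℝ≥0∞) : EReal)

/-- The arithmetic mean `(1/N) ∑ᵢ aᵢ` of extended reals, with the same convention: it is `+∞` as
soon as one of the `aᵢ` is `+∞`. -/
def extMean {N : ℕ} (a : Fin N → EReal) : EReal :=
  open Classical in
  if ∃ i, a i = ⊤ then ⊤ else ((1 / (N : ℝ) : ℝ) : EReal) * ∑ i, a i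

/-- The uniform (empirical) distribution on the points `w 0, …, w (N-1)`. -/
def empiricalMeasure {l N : ℕ} (w : Fin N → Euc l) : Measure (Euc l) :=
  ((N : ℝ≥0∞))⁻¹ • ∑ i, Measure.dirac (w i)

/-- The random variable `Z + E[(X - Z)⁺ / (1 - α) | 𝒢]`. The conditional expectation is that of a
nonnegative function, with values in `[0, ∞]`. -/
def condCVaRObjective {Ω : Type*} {mΩ : MeasurableSpace Ω} (μ : Measure Ω) (𝒢 : MeasurableSpace Ω)
    (α : ℝ) (X Z : Ω → ℝ) (ω : Ω) : EReal :=
  (Z ω : EReal) +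
    ((condLExp 𝒢 μ (fun ω' => ENNReal.ofReal (max (X ω' - Z ω') 0 / (1 - α))) ω : ℝ≥0∞) : EReal)

/-- `C` is (a version of) the conditional value-at-risk
`CVaR_α[X | 𝒢] = min_{Z ∈ L²(Ω, 𝒢, μ)} Z + E[(X - Z)⁺ / (1 - α) | 𝒢]`, the minimum of a family of
random variables being its greatest lower bound for the almost sure order. -/
structure IsCondCVaR {Ω : Type*} {mΩ : MeasurableSpace Ω} (μ : Measure Ω) (𝒢 : MeasurableSpace Ω)
    (α : ℝ) (X : Ω → ℝ) (C : Ω → EReal) : Prop where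
  measurable : Measurable[𝒢] C
  le_objective : ∀ Z : Ω → ℝ, Measurable[𝒢] Z → MemLp Z 2 μ →
    ∀ᵐ ω ∂μ, C ω ≤ condCVaRObjective μ 𝒢 α X Z ω
  greatest : ∀ C' : Ω → EReal, Measurable[𝒢] C' →
    (∀ Z : Ω → ℝ, Measurable[𝒢] Z → MemLp Z 2 μ →
      ∀ᵐ ω ∂μ, C' ω ≤ condCVaRObjective μ 𝒢 α X Z ω) →
    ∀ᵐ ω ∂μ, C' ω ≤ C ω

/-- The data of a safety-constrained stochastic optimal control problem with states in `ℝⁿ`,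
controls in `U ⊆ ℝᵐ` and independent disturbances in `ℝˡ` of common distribution `P`:
dynamics `x_{t+1} = f(x_t, u_t, w_t)`, stage cost `r`, terminal cost `q`, safe set `A`,
risk level `α`, risk tolerance `δ`, and horizon `T`. -/
structure SafeControlProblem (n m l : ℕ) where
  f : Euc n → Euc m → Euc l → Euc n
  measurable_f : Measurable (fun p : Euc n × Euc m × Euc l => f p.1 p.2.1 p.2.2)
  U : Set (Euc m)
  convex_U : Convex ℝ U
  nonempty_U : U.Nonempty
  P : Measure (Euc l)
  isProb : IsProbabilityMeasure P
  r : Euc n → Euc m → ℝ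
  measurable_r : Measurable (fun p : Euc n × Euc m => r p.1 p.2)
  q : Euc n → ℝ
  measurable_q : Measurable q
  A : Set (Euc n)
  convex_A : Convex ℝ A
  isCompact_A : IsCompact A
  nonempty_A : A.Nonempty
  α : ℝ
  α_pos : 0 < α
  α_lt_one : α < 1
  δ : ℝ
  δ_nonneg : 0 ≤ δ
  T : ℕ

namespace SafeControlProblem

variable {n m l : ℕ} (S : SafeControlProblem n m l)

/-- Histories `(x_0, …, x_i ; w_0, …, w_{i-1})` up to stage `i`. -/
abbrev Hist (n l i : ℕ) : Type := (Fin (i + 1) → Euc n) × (Fin i → Euc l)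

/-- The history that consists of an initial state only. -/
def initHist (l : ℕ) {n : ℕ} (x : Euc n) : Hist n l 0 := (fun _ => x, Fin.elim0)

/-- The history obtained when control `u` is applied and disturbance `w` occurs after `h`. -/
def extendHist (i : ℕ) (p : Hist n l i × (S.U × Euc l)) : Hist n l (i + 1) :=
  (Fin.snoc (α := fun _ => Euc n) p.1.1 (S.f (p.1.1 (Fin.last i)) p.2.1 p.2.2),
    Fin.snoc (α := fun _ => Euc l) p.1.2 p.2.2)

theorem measurable_extendHist (i : ℕ) : Measurable (S.extendHist i) := by
  have hx : Measurable (fun p : Hist n l i × (S.U × Euc l) =>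
      S.f (p.1.1 (Fin.last i)) p.2.1 p.2.2) := by
    apply S.measurable_f.comp (f := fun p : Hist n l i × (S.U × Euc l) =>
      (p.1.1 (Fin.last i), (p.2.1 : Euc m), p.2.2))
    fun_prop
  unfold extendHist
  refine Measurable.prodMk (measurable_pi_lambda _ fun a => ?_)
    (measurable_pi_lambda _ fun a => ?_)
  · refine Fin.lastCases ?_ (fun b => ?_) a
    · simpa using hx
    · simp only [Fin.snoc_castSucc]
      fun_prop
  · refine Fin.lastCases ?_ (fun b => ?_) a
    · simp only [Fin.snoc_last]
      fun_prop
    · simp only [Fin.snoc_castSucc]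
      fun_prop

/-- Admissible strategies: sequences of stochastic kernels from histories to the control set. -/
def Policy : Type :=
  {π : (i : ℕ) → Kernel (Hist n l i) S.U // ∀ i, IsMarkovKernel (π i)}

/-- `S.pathLaw π k i h` is the law of the controls and disturbances of the `k` stages that follow
the history `h` of length `i`, when strategy `π` is used: `u` is drawn from `π_i(· | h)`,
`w` independently from `P`, and the evolution continues from the extended history. -/
def pathLaw (π : S.Policy) : (k i : ℕ) → Kernel (Hist n l i) (Fin k → S.U × Euc l)
  | 0, _ => Kernel.const _ (Measure.dirac Fin.elim0)
  | k + 1, i =>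
      ((π.1 i ×ₖ Kernel.const (Hist n l i) S.P) ⊗ₖ
        ((pathLaw π k (i + 1)).comap (S.extendHist i) (S.measurable_extendHist i))).map
        (fun p => Fin.cons (α := fun _ => S.U × Euc l) p.1 p.2)

/-- The law of controls and disturbances over `k` stages, from the initial state `x`. -/
def law (π : S.Policy) (k : ℕ) (x : Euc n) : Measure (Fin k → S.U × Euc l) :=
  S.pathLaw π k 0 (initHist l x)

/-- The states `x_0 = x`, `x_{j+1} = f(x_j, u_j, w_j)` along a path `((u_j, w_j))_{j < k}`. -/
def state {k : ℕ} (x : Euc n) (ω : Fin k → S.U × Euc l) (j : Fin (k + 1)) : Euc n :=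
  Fin.induction (motive := fun _ => Euc n) x (fun i y => S.f y (ω i).1 (ω i).2) j

/-- The total cost `∑_{j<k} r(x_j, u_j) + q(x_k)` of a path. -/
def totalCost {k : ℕ} (x : Euc n) (ω : Fin k → S.U × Euc l) : ℝ :=
  ∑ j : Fin k, S.r (S.state x ω j.castSucc) (ω j).1 + S.q (S.state x ω (Fin.last k))

/-- The information available just before the disturbance `w_j` is realized: the σ-algebra
generated by `(u_i, w_i)`, `i < j`, and by `u_j` (the state `x_j` is a function of these). -/
@[reducible] def info {k : ℕ} (j : Fin k) : MeasurableSpace (Fin k → S.U × Euc l) :=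
  MeasurableSpace.comap
    (fun ω => ((fun i : {i : Fin k // i < j} => ω i.1), (ω j).1)) inferInstance

/-- The risk constraints `CVaR_α[dist(x_{j+1}, A) | ℱ_{j-1}] ≤ δ` a.s., for all stages `j < k`. -/
def Feasible (π : S.Policy) (k : ℕ) (x : Euc n) : Prop :=
  ∀ j : Fin k, ∃ C : (Fin k → S.U × Euc l) → EReal,
    IsCondCVaR (S.law π k x) (S.info j) S.α
      (fun ω => Metric.infDist (S.state x ω j.succ) S.A) C ∧
    ∀ᵐ ω ∂(S.law π k x), C ω ≤ (S.δ : EReal)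

/-- The value function `v_t(x)` for `t ≤ T`: the infimum, over the admissible strategies that
satisfy the risk constraints of stages `t, …, T-1`, of the expected cost of the stages
`t, …, T` when the state at stage `t` is `x`. Time is counted from `t`: `T - t` stages remain and
the history at stage `t` is `x`. -/
def value (t : ℕ) (x : Euc n) : EReal :=
  ⨅ (π : S.Policy) (_ : S.Feasible π (S.T - t) x),
    extExpect (S.law π (S.T - t) x) (fun ω => (S.totalCost x ω : EReal))

/-- The right-hand side of the Bellman equation with expectation constraint:
`inf_{u ∈ U, z ∈ ℝ} r(x,u) + E[V(f(x,u,w))]`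
subject to `E[z + (dist(f(x,u,w), A) - z)⁺ / (1 - α)] ≤ δ`. -/
def bellmanRHS (V : Euc n → EReal) (x : Euc n) : EReal :=
  ⨅ (u ∈ S.U) (z : ℝ) (_ : extExpect S.P (fun w =>
      ((z + max (Metric.infDist (S.f x u w) S.A - z) 0 / (1 - S.α) : ℝ) : EReal)) ≤ (S.δ : EReal)),
    (S.r x u : EReal) + extExpect S.P (fun w => V (S.f x u w))

/-- The right-hand side of the deterministic Bellman equation for the points `w i`:
`inf_{u ∈ U, y ∈ A^N, z ∈ ℝ} r(x,u) + (1/N) ∑ᵢ V(f(x,u,wᵢ))`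
subject to `z + ∑ᵢ (‖f(x,u,wᵢ) - yᵢ‖ - z)⁺ / (N (1 - α)) ≤ δ`. -/
def finiteBellmanRHS {N : ℕ} (w : Fin N → Euc l) (V : Euc n → EReal) (x : Euc n) : EReal :=
  ⨅ (u ∈ S.U) (y : Fin N → Euc n) (_ : ∀ i, y i ∈ S.A) (z : ℝ)
    (_ : z + (∑ i, max (‖S.f x u (w i) - y i‖ - z) 0) / ((N : ℝ) * (1 - S.α)) ≤ S.δ),
    (S.r x u : EReal) + extMean (fun i => V (S.f x u (w i)))

end SafeControlProblem

end

/-!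
The two Bellman equations have the same right-hand side: under the uniform distribution on the
points `w i`, expectations are means over `i`, and since `A` is compact the distance to `A` is
attained at some `y i ∈ A`, so that minimizing over `y` as well replaces `‖f(x,u,wᵢ) - yᵢ‖` by
`dist(f(x,u,wᵢ), A)` (`bellmanRHS_eq`, `finiteBellmanRHS_eq`).

The substance is dynamic programming for the value function, which has to deal with randomized,
history-dependent strategies. Three facts carry it.

* Along the path law of any strategy, the disturbance of a stage is independent of the information
  before it (`lintegral_pathLaw_disturbance`). Hence the conditional value-at-risk of stage `j` is a
  fixed function `stageRisk` of the current state and control, and feasibility says that it is at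
  most `δ` almost surely at all stages (`feasible_iff`). The constants `Z` with rational values
  already have the right essential infimum, so neither a measurable selection nor integrability of
  the distance is needed. The one-stage objective is continuous in `z`, and coercive because
  `0 < α`, so `stageRisk ≤ δ` produces a feasible `z` (`stageRisk_le_iff`).
* The path law is that of a first control and disturbance followed by the path law of the shifted
  strategy (`lintegral_law_succ`). Feasibility and cost split accordingly (`feasible_succ_iff`,
  `r_add_extMean_extExpect`), and almost every first control, followed by the shifted strategies,
  costs at least the right-hand side of the Bellman equation. Integrating over the first control
  gives `finiteBellmanRHS_le_horizonValue`; the measurability of the value function is not used.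
* Only finitely many states can follow a deterministic first control, so strategies that are nearly
  optimal from each of them can be pasted measurably (`glue`). Letting them approach the optimum
  gives `horizonValue_le_finiteBellmanRHS`. The mean of extended reals is continuous where no entry
  is `+∞`, and if some entry is `+∞` there is nothing to prove.
-/

open Filter Topology

/-! ### Extended expectations and means -/

theorem extExpect_coe {Ω : Type*} [MeasurableSpace Ω] (μ : Measure Ω) (g : Ω → ℝ) :
    extExpect μ (fun ω => (g ω : EReal)) =
      if ∫⁻ ω, ENNReal.ofReal (g ω) ∂μ = ⊤ then ⊤
      else ((∫⁻ ω, ENNReal.ofReal (g ω) ∂μ : ℝ≥0∞) : EReal) -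
        ((∫⁻ ω, ENNReal.ofReal (-g ω) ∂μ : ℝ≥0∞) : EReal) := by
  simp only [extExpect, ← EReal.coe_neg, EReal.real_coe_toENNReal]
  congr

theorem extExpect_const_add {Ω : Type*} [MeasurableSpace Ω] (μ : Measure Ω)
    [IsProbabilityMeasure μ] (c : ℝ) {g : Ω → ℝ} (hg : Measurable g) :
    extExpect μ (fun ω => ((c + g ω : ℝ) : EReal)) =
      (c : EReal) + extExpect μ (fun ω => (g ω : EReal)) := by
  rw [extExpect_coe, extExpect_coe]
  -- `a⁺ - a⁻ = a` for `a = c + g, g, c`, arranged so that no subtraction of infinities occurs.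
  have key : ∫⁻ ω, ENNReal.ofReal (c + g ω) ∂μ + ∫⁻ ω, ENNReal.ofReal (-g ω) ∂μ
      + ENNReal.ofReal (-c) =
      ∫⁻ ω, ENNReal.ofReal (-(c + g ω)) ∂μ + ∫⁻ ω, ENNReal.ofReal (g ω) ∂μ
      + ENNReal.ofReal c := by
    have h1 : ∀ a : ℝ, ENNReal.ofReal a = ∫⁻ _, ENNReal.ofReal a ∂μ := by simp
    rw [h1 c, h1 (-c), ← lintegral_add_left (by fun_prop), ← lintegral_add_left (by fun_prop),
      ← lintegral_add_left (by fun_prop), ← lintegral_add_left (by fun_prop)]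
    refine lintegral_congr fun ω => ?_
    simp only [ENNReal.ofReal]
    norm_cast
    ext
    push_cast [Real.coe_toNNReal']
    have h2 : ∀ a : ℝ, max a 0 - max (-a) 0 = a := fun a => by
      rcases le_total a 0 with h | h <;> simp [h]
    linarith [h2 (c + g ω), h2 (g ω), h2 c]
  have hle : ∀ (a : ℝ) (f : Ω → ℝ), ∫⁻ ω, ENNReal.ofReal (a + f ω) ∂μ ≤
      ENNReal.ofReal a + ∫⁻ ω, ENNReal.ofReal (f ω) ∂μ := fun a f => by
    calc _ ≤ ∫⁻ ω, (ENNReal.ofReal a + ENNReal.ofReal (f ω)) ∂μ :=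
          lintegral_mono fun ω => ENNReal.ofReal_add_le
      _ = _ := by rw [lintegral_add_left (by fun_prop)]; simp
  have hiff : ∫⁻ ω, ENNReal.ofReal (c + g ω) ∂μ = ⊤ ↔ ∫⁻ ω, ENNReal.ofReal (g ω) ∂μ = ⊤ := by
    constructor
    · intro h
      have := hle c g
      rw [h, top_le_iff, ENNReal.add_eq_top] at this
      simpa using this
    · intro h
      have := hle (-c) (fun ω => c + g ω)
      simp only [neg_add_cancel_left] at this
      rw [h, top_le_iff, ENNReal.add_eq_top] at this
      simpa using this
  by_cases hA : ∫⁻ ω, ENNReal.ofReal (g ω) ∂μ = ⊤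
  · rw [if_pos hA, if_pos (hiff.2 hA)]; simp
  have hA' := fun h => hA (hiff.1 h)
  rw [if_neg hA, if_neg hA']
  generalize ∫⁻ ω, ENNReal.ofReal (c + g ω) ∂μ = A' at *
  generalize ∫⁻ ω, ENNReal.ofReal (g ω) ∂μ = A at *
  generalize ∫⁻ ω, ENNReal.ofReal (-(c + g ω)) ∂μ = B' at *
  generalize ∫⁻ ω, ENNReal.ofReal (-g ω) ∂μ = B at *
  lift A to NNReal using hA
  lift A' to NNReal using hA'
  by_cases hB : B = ⊤
  · have hB' : B' = ⊤ := by
      by_contra h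
      subst hB
      lift B' to NNReal using h
      simp [ENNReal.ofReal] at key
      norm_cast at key
    simp [hB, hB']
  have hB' : B' ≠ ⊤ := by
    rintro rfl
    lift B to NNReal using hB
    simp [ENNReal.ofReal] at key
  lift B to NNReal using hB
  lift B' to NNReal using hB'
  simp only [ENNReal.ofReal] at key
  norm_cast at key
  have key2 := congrArg (fun a : NNReal => (a : ℝ)) key
  push_cast [Real.coe_toNNReal'] at key2
  have h2 : max c 0 - max (-c) 0 = c := by
      rcases le_total c 0 with h | h <;> simp [h]
  have h3 : ∀ a : NNReal, ((a : ℝ≥0∞) : EReal) = ((a : ℝ) : EReal) := fun a => rfl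
  simp only [h3]
  norm_cast
  linarith

theorem extMean_const_add {N : ℕ} (hN : 0 < N) (c : ℝ) (a : Fin N → EReal) :
    extMean (fun i => (c : EReal) + a i) = (c : EReal) + extMean a := by
  have hiff : (∃ i, (c : EReal) + a i = ⊤) ↔ ∃ i, a i = ⊤ := by
    refine exists_congr fun i => ?_
    induction a i <;> simp
    exact (EReal.coe_add _ _ ▸ EReal.coe_ne_top _)
  unfold extMean
  by_cases h : ∃ i, a i = ⊤
  · rw [if_pos h, if_pos (hiff.2 h)]; simp
  rw [if_neg h, if_neg (fun h' => h (hiff.1 h')), Finset.sum_add_distrib,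
    EReal.left_distrib_of_nonneg_of_ne_top (by exact_mod_cast (by positivity)) (EReal.coe_ne_top _)]
  congr 1
  have : ∑ _i : Fin N, (c : EReal) = ((N * c : ℝ) : EReal) := by simp [EReal.nsmul_eq_mul]
  rw [this]
  norm_cast
  field_simp

theorem extMean_sub {N : ℕ} (a b : Fin N → ℝ≥0∞) (ha : ∀ i, a i ≠ ⊤) :
    extMean (fun i => (a i : EReal) - (b i : EReal)) =
      (((N : ℝ≥0∞)⁻¹ * ∑ i, a i : ℝ≥0∞) : EReal) - (((N : ℝ≥0∞)⁻¹ * ∑ i, b i : ℝ≥0∞) : EReal) := by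
  rcases Nat.eq_zero_or_pos N with rfl | hN
  · simp [extMean]
  have hne : ¬ ∃ i, (a i : EReal) - (b i : EReal) = ⊤ := by
    rintro ⟨i, hi⟩
    have h1 : (a i : EReal) - (b i : EReal) ≤ a i := by
      simpa using EReal.sub_le_sub (le_refl (a i : EReal)) (EReal.coe_ennreal_nonneg (b i))
    rw [hi, top_le_iff, EReal.coe_ennreal_eq_top_iff] at h1
    exact ha i h1
  rw [extMean, if_neg hne]
  have hsum : ∀ s : Finset (Fin N), ∑ i ∈ s, ((a i : EReal) - (b i : EReal)) =
      ((∑ i ∈ s, a i : ℝ≥0∞) : EReal) - ((∑ i ∈ s, b i : ℝ≥0∞) : EReal) := by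
    intro s
    induction s using Finset.induction_on with
    | empty => simp
    | insert j s hj ih =>
      rw [Finset.sum_insert hj, Finset.sum_insert hj, Finset.sum_insert hj, ih,
        EReal.coe_ennreal_add, EReal.coe_ennreal_add, EReal.add_sub_add_comm]
      · exact Or.inl (EReal.coe_ennreal_ne_bot _)
      · exact Or.inr (EReal.coe_ennreal_ne_bot _)
  have hc : ∀ x : ℝ≥0∞, ((1 / (N : ℝ) : ℝ) : EReal) * (x : EReal) =
      (((N : ℝ≥0∞)⁻¹ * x : ℝ≥0∞) : EReal) := by
    intro x
    rw [EReal.coe_ennreal_mul]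
    congr 1
    have : ((N : ℝ≥0∞)⁻¹) = (((N : NNReal)⁻¹ : NNReal) : ℝ≥0∞) := by
      rw [ENNReal.coe_inv (by positivity)]; simp
    rw [this]
    have h3 : ∀ a : NNReal, ((a : ℝ≥0∞) : EReal) = ((a : ℝ) : EReal) := fun a => rfl
    rw [h3]
    simp
  rw [hsum, EReal.mul_sub_of_nonneg_of_ne_top (by exact_mod_cast (by positivity))
    (EReal.coe_ne_top _), hc, hc]

/-- An extended expectation under a finite uniform mixture is the mean of the extended
expectations of the components. -/
theorem extMean_ite_sub {N : ℕ} (hN : 0 < N) (a b : Fin N → ℝ≥0∞) :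
    extMean (fun i => if a i = ⊤ then ⊤ else (a i : EReal) - (b i : EReal)) =
      if (N : ℝ≥0∞)⁻¹ * ∑ i, a i = ⊤ then ⊤ else
      (((N : ℝ≥0∞)⁻¹ * ∑ i, a i : ℝ≥0∞) : EReal) - (((N : ℝ≥0∞)⁻¹ * ∑ i, b i : ℝ≥0∞) : EReal) := by
  have hiff : (N : ℝ≥0∞)⁻¹ * ∑ i, a i = ⊤ ↔ ∃ i, a i = ⊤ := by
    have : (N : ℝ≥0∞) ≠ 0 := by positivity
    rw [ENNReal.mul_eq_top]
    simp [this]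
  by_cases h : ∃ i, a i = ⊤
  · rw [if_pos (hiff.2 h), extMean, if_pos]
    exact h.imp fun i hi => by simp [hi]
  · rw [if_neg (fun h' => h (hiff.1 h')), ← extMean_sub a b (fun i hi => h ⟨i, hi⟩)]
    congr 1
    ext i
    rw [if_neg fun hi => h ⟨i, hi⟩]

theorem lintegral_empiricalMeasure {l N : ℕ} (w : Fin N → Euc l) (g : Euc l → ℝ≥0∞) :
    ∫⁻ y, g y ∂(empiricalMeasure w) = (N : ℝ≥0∞)⁻¹ * ∑ i, g (w i) := by
  simp [empiricalMeasure]

theorem extExpect_empiricalMeasure {l N : ℕ} (hN : 0 < N) (w : Fin N → Euc l)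
    (g : Euc l → EReal) :
    extExpect (empiricalMeasure w) g = extMean (fun i => g (w i)) := by
  rw [extExpect, lintegral_empiricalMeasure, lintegral_empiricalMeasure,
    ← extMean_ite_sub hN]
  congr 1
  ext i
  induction g (w i) with
  | bot => simp
  | top => simp
  | coe x =>
    rw [← EReal.coe_neg, EReal.real_coe_toENNReal, EReal.real_coe_toENNReal,
      if_neg ENNReal.ofReal_ne_top]
    exact (EReal.coe_real_ereal_eq_coe_toNNReal_sub_coe_toNNReal x).symm

theorem extMean_coe {N : ℕ} (a : Fin N → ℝ) :
    extMean (fun i => (a i : EReal)) = ((1 / (N : ℝ) * ∑ i, a i : ℝ) : EReal) := by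
  rw [extMean, if_neg (by simp)]
  have : ∀ s : Finset (Fin N), ∑ i ∈ s, (a i : EReal) = ((∑ i ∈ s, a i : ℝ) : EReal) := fun s => by
    induction s using Finset.induction_on with
    | empty => simp
    | insert j s hj ih => rw [Finset.sum_insert hj, Finset.sum_insert hj, ih, EReal.coe_add]
  rw [this, EReal.coe_mul]

theorem extMean_mono {N : ℕ} {a b : Fin N → EReal} (h : ∀ i, a i ≤ b i) :
    extMean a ≤ extMean b := by
  unfold extMean
  by_cases hb : ∃ i, b i = ⊤
  · simp [hb]
  have ha : ¬ ∃ i, a i = ⊤ := fun ⟨i, hi⟩ => hb ⟨i, top_le_iff.1 (hi ▸ h i)⟩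
  rw [if_neg ha, if_neg hb]
  exact mul_le_mul_of_nonneg_left (Finset.sum_le_sum fun i _ => h i)
    (by exact_mod_cast (by positivity))

/-- The mean is continuous at points without entries `+∞`; entries `-∞` are allowed. -/
theorem tendsto_extMean {N : ℕ} {a : ℕ → Fin N → EReal} {b : Fin N → EReal}
    (hb : ∀ i, b i ≠ ⊤) (h : ∀ i, Tendsto (fun k => a k i) atTop (𝓝 (b i))) :
    Tendsto (fun k => extMean (a k)) atTop (𝓝 (extMean b)) := by
  have hev : ∀ᶠ k in atTop, ((1 / (N : ℝ) : ℝ) : EReal) * ∑ i, a k i = extMean (a k) := by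
    have : ∀ᶠ k in atTop, ∀ i, a k i ≠ ⊤ :=
      eventually_all.2 fun i => (h i).eventually_ne (hb i)
    filter_upwards [this] with k hk
    rw [extMean, if_neg (by simpa using hk)]
  refine Tendsto.congr' hev ?_
  rw [extMean, if_neg (by simpa using hb)]
  have hs : ∀ s : Finset (Fin N), ∑ i ∈ s, b i ≠ ⊤ ∧
      Tendsto (fun k => ∑ i ∈ s, a k i) atTop (𝓝 (∑ i ∈ s, b i)) := fun s => by
    induction s using Finset.induction_on with
    | empty => simp
    | insert j s hj ih =>
      simp only [Finset.sum_insert hj]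
      refine ⟨EReal.add_ne_top (hb j) ih.1, ?_⟩
      exact (EReal.continuousAt_add (p := (b j, ∑ i ∈ s, b i)) (Or.inl (hb j))
        (Or.inr ih.1)).tendsto.comp ((h j).prodMk_nhds ih.2)
  exact EReal.Tendsto.const_mul (hs _).2 (Or.inl (EReal.coe_ne_bot _)) (Or.inl (EReal.coe_ne_top _))

/-- Monotonicity of the extended expectation, for a constant lower bound; `a` and `b` play the roles
of the positive and negative parts. -/
theorem le_lintegral_sub_lintegral {Ω : Type*} [MeasurableSpace Ω] (μ : Measure Ω)
    [IsProbabilityMeasure μ] {a b : Ω → ℝ≥0∞} (ha : Measurable a)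
    (hfin : ∫⁻ ω, a ω ∂μ ≠ ⊤) {R : EReal}
    (hR : ∀ᵐ ω ∂μ, a ω ≠ ⊤ → R ≤ (a ω : EReal) - (b ω : EReal)) :
    R ≤ ((∫⁻ ω, a ω ∂μ : ℝ≥0∞) : EReal) - ((∫⁻ ω, b ω ∂μ : ℝ≥0∞) : EReal) := by
  have hR' : ∀ᵐ ω ∂μ, a ω ≠ ⊤ ∧ R ≤ (a ω : EReal) - (b ω : EReal) := by
    filter_upwards [hR, ae_lt_top ha hfin] with ω h1 h2 using ⟨h2.ne, h1 h2.ne⟩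
  induction R with
  | bot => simp
  | top =>
    obtain ⟨ω, h1, h2⟩ := hR'.exists
    exfalso
    have h3 : (a ω : EReal) - (b ω : EReal) ≤ a ω := by
      simpa using EReal.sub_le_sub (le_refl (a ω : EReal)) (EReal.coe_ennreal_nonneg (b ω))
    have h4 := h2.trans h3
    rw [top_le_iff, EReal.coe_ennreal_eq_top_iff] at h4
    exact h1 h4
  | coe c =>
    -- Without subtraction, the inequality can be integrated in `[0, ∞]`.
    have hiff : ∀ A B : ℝ≥0∞, A ≠ ⊤ → ((c : EReal) ≤ (A : EReal) - (B : EReal) ↔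
        ENNReal.ofReal c + B ≤ A + ENNReal.ofReal (-c)) := by
      intro A B hA
      lift A to NNReal using hA
      by_cases hB : B = ⊤
      · subst hB
        simp [ENNReal.ofReal]
      lift B to NNReal using hB
      have h3 : ∀ a : NNReal, ((a : ℝ≥0∞) : EReal) = ((a : ℝ) : EReal) := fun a => rfl
      rw [h3, h3]
      simp only [ENNReal.ofReal]
      norm_cast
      rw [← NNReal.coe_le_coe]
      push_cast [Real.coe_toNNReal']
      have h2 : max c 0 - max (-c) 0 = c := by
        rcases le_total c 0 with h | h <;> simp [h]
      constructor <;> intro h <;> linarith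
    rw [hiff _ _ hfin]
    have h1 : ∀ r : ℝ, ENNReal.ofReal r = ∫⁻ _, ENNReal.ofReal r ∂μ := by simp
    rw [h1 c, h1 (-c), ← lintegral_add_left (by fun_prop), ← lintegral_add_left ha]
    refine lintegral_mono_ae ?_
    filter_upwards [hR'] with ω h
    exact (hiff _ _ h.1).1 h.2

/-! ### The one-stage problem -/

namespace SafeControlProblem

variable {n m l : ℕ} (S : SafeControlProblem n m l)

/-- The objective `z + (1/(N(1-α))) ∑ᵢ (dist(f(x,u,wᵢ), A) - z)⁺` of the one-stage
Rockafellar–Uryasev program: its minimum over `z` is the conditional value-at-risk. -/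
noncomputable def riskObjective {N : ℕ} (w : Fin N → Euc l) (x : Euc n) (u : Euc m) (z : ℝ) : ℝ :=
  z + (∑ i, max (Metric.infDist (S.f x u (w i)) S.A - z) 0) / ((N : ℝ) * (1 - S.α))

theorem extExpect_le_iff_riskObjective_le {N : ℕ} (hN : 0 < N) {w : Fin N → Euc l}
    (hP : S.P = empiricalMeasure w) (x : Euc n) (u : Euc m) (z : ℝ) :
    extExpect S.P (fun w =>
      ((z + max (Metric.infDist (S.f x u w) S.A - z) 0 / (1 - S.α) : ℝ) : EReal)) ≤ (S.δ : EReal)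
      ↔ S.riskObjective w x u z ≤ S.δ := by
  rw [hP, extExpect_empiricalMeasure hN, extMean_coe, EReal.coe_le_coe_iff]
  have : 1 - S.α ≠ 0 := (sub_pos.2 S.α_lt_one).ne'
  rw [riskObjective, Finset.sum_add_distrib, ← Finset.sum_div]
  simp only [Finset.sum_const, Finset.card_univ, Fintype.card_fin, nsmul_eq_mul]
  have : 1 / (N : ℝ) * (N * z + (∑ i, max (Metric.infDist (S.f x u (w i)) S.A - z) 0) / (1 - S.α)) =
    z + (∑ i, max (Metric.infDist (S.f x u (w i)) S.A - z) 0) / (N * (1 - S.α)) := by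
    field_simp
  rw [this]

theorem riskObjective_le_iff_exists {N : ℕ} (w : Fin N → Euc l) (x : Euc n) (u : Euc m) (z : ℝ) :
    S.riskObjective w x u z ≤ S.δ ↔ ∃ y : Fin N → Euc n, (∀ i, y i ∈ S.A) ∧
      z + (∑ i, max (‖S.f x u (w i) - y i‖ - z) 0) / ((N : ℝ) * (1 - S.α)) ≤ S.δ := by
  have h1 : 0 ≤ (N : ℝ) * (1 - S.α) := mul_nonneg (by positivity) (sub_pos.2 S.α_lt_one).le
  constructor
  · intro h
    choose y hy hd using fun i => S.isCompact_A.exists_infDist_eq_dist S.nonempty_A (S.f x u (w i))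
    refine ⟨y, hy, ?_⟩
    simpa only [riskObjective, hd, dist_eq_norm] using h
  · rintro ⟨y, hy, h⟩
    refine le_trans ?_ h
    unfold riskObjective
    gcongr with i
    rw [← dist_eq_norm]
    exact Metric.infDist_le_dist_of_mem (hy i)

theorem bellmanRHS_eq {N : ℕ} (hN : 0 < N) {w : Fin N → Euc l}
    (hP : S.P = empiricalMeasure w) (V : Euc n → EReal) (x : Euc n) :
    S.bellmanRHS V x = ⨅ (u ∈ S.U) (z : ℝ) (_ : S.riskObjective w x u z ≤ S.δ),
      (S.r x u : EReal) + extMean (fun i => V (S.f x u (w i))) := by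
  simp only [bellmanRHS, S.extExpect_le_iff_riskObjective_le hN hP]
  simp only [hP, extExpect_empiricalMeasure hN]

/-- Minimizing over the points `y i ∈ A` amounts to replacing the norms by distances to `A`. -/
theorem finiteBellmanRHS_eq {N : ℕ} (w : Fin N → Euc l) (V : Euc n → EReal) (x : Euc n) :
    S.finiteBellmanRHS w V x = ⨅ (u ∈ S.U) (z : ℝ) (_ : S.riskObjective w x u z ≤ S.δ),
      (S.r x u : EReal) + extMean (fun i => V (S.f x u (w i))) := by
  simp only [finiteBellmanRHS]
  refine le_antisymm ?_ ?_
  · refine le_iInf₂ fun u hu => le_iInf₂ fun z hz => ?_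
    obtain ⟨y, hy, h⟩ := (S.riskObjective_le_iff_exists w x u z).1 hz
    exact iInf₂_le_of_le u hu <| iInf₂_le_of_le y hy <| iInf₂_le_of_le z h le_rfl
  · refine le_iInf₂ fun u hu => le_iInf₂ fun y hy => le_iInf₂ fun z hz => ?_
    exact iInf₂_le_of_le u hu <|
      iInf₂_le_of_le z ((S.riskObjective_le_iff_exists w x u z).2 ⟨y, hy, hz⟩) le_rfl

/-! ### Path laws -/

instance : IsProbabilityMeasure S.P := S.isProb

instance (π : S.Policy) (i : ℕ) : IsMarkovKernel (π.1 i) := π.2 i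

theorem measurable_finCons {α : Type*} [MeasurableSpace α] (k : ℕ) :
    Measurable (fun p : α × (Fin k → α) => Fin.cons (α := fun _ => α) p.1 p.2) := by
  refine measurable_pi_lambda _ fun j => ?_
  refine Fin.cases ?_ (fun j => ?_) j
  · simp only [Fin.cons_zero]; fun_prop
  · simp only [Fin.cons_succ]; fun_prop

instance isMarkovKernel_pathLaw (π : S.Policy) (k i : ℕ) : IsMarkovKernel (S.pathLaw π k i) := by
  induction k generalizing i with
  | zero => rw [pathLaw]; infer_instance
  | succ k ih =>
    rw [pathLaw]
    have := ih (i + 1)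
    exact Kernel.IsMarkovKernel.map _ (measurable_finCons k)

instance isProbabilityMeasure_law (π : S.Policy) (k : ℕ) (x : Euc n) :
    IsProbabilityMeasure (S.law π k x) := by
  rw [law]; infer_instance

theorem measurable_lintegral_pathLaw_extendHist (π : S.Policy) (k i : ℕ)
    {F : (Fin (k + 1) → S.U × Euc l) → ℝ≥0∞} (hF : Measurable F) :
    Measurable (fun p : Hist n l i × (S.U × Euc l) =>
      ∫⁻ ω, F (Fin.cons p.2 ω) ∂(S.pathLaw π k (i + 1) (S.extendHist i p))) := by
  have h := Measurable.lintegral_kernel_prod_right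
    (κ := (S.pathLaw π k (i + 1)).comap (S.extendHist i) (S.measurable_extendHist i))
    (f := fun (p : Hist n l i × (S.U × Euc l)) ω => F (Fin.cons (α := fun _ => S.U × Euc l) p.2 ω))
    (hF.comp ((measurable_finCons k).comp (f := fun q : (Hist n l i × (S.U × Euc l)) ×
      (Fin k → S.U × Euc l) => (q.1.2, q.2)) (by fun_prop)))
  simpa only [Kernel.comap_apply] using h

/-- The tower property for the law of paths: the first control is drawn from the strategy, the
first disturbance independently from `P`, and the rest of the path from the extended history. -/
theorem lintegral_pathLaw_succ (π : S.Policy) (k i : ℕ) (h : Hist n l i)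
    {F : (Fin (k + 1) → S.U × Euc l) → ℝ≥0∞} (hF : Measurable F) :
    ∫⁻ ω, F ω ∂(S.pathLaw π (k + 1) i h) =
      ∫⁻ u, ∫⁻ w, ∫⁻ ω, F (Fin.cons (u, w) ω)
        ∂(S.pathLaw π k (i + 1) (S.extendHist i (h, (u, w)))) ∂S.P ∂(π.1 i h) := by
  rw [pathLaw, Kernel.lintegral_map _ (measurable_finCons k) _ hF]
  refine (Kernel.lintegral_compProd _ _ _ (hF.comp (measurable_finCons k))).trans ?_
  rw [Kernel.prod_apply, Kernel.const_apply, lintegral_prod]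
  · rfl
  · exact ((S.measurable_lintegral_pathLaw_extendHist π k i hF).comp
      (measurable_const.prodMk measurable_id : Measurable fun q : S.U × Euc l => (h, q))).aemeasurable

/-- The history whose first state and disturbance are `x` and `w`, followed by `h`. -/
def prependHist (i : ℕ) (x : Euc n) (w : Euc l) (h : Hist n l i) : Hist n l (i + 1) :=
  (Fin.cons (α := fun _ => Euc n) x h.1, Fin.cons (α := fun _ => Euc l) w h.2)

theorem measurable_prependHist (i : ℕ) (x : Euc n) (w : Euc l) :
    Measurable (prependHist i x w) := by
  refine Measurable.prodMk ?_ ?_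
  · exact (measurable_finCons (i + 1)).comp (f := fun h : Hist n l i => (x, h.1)) (by fun_prop)
  · exact (measurable_finCons i).comp (f := fun h : Hist n l i => (w, h.2)) (by fun_prop)

theorem extendHist_prependHist (i : ℕ) (x : Euc n) (w : Euc l) (h : Hist n l i)
    (a : S.U × Euc l) :
    S.extendHist (i + 1) (prependHist i x w h, a) = prependHist (i + 1) x w (S.extendHist i (h, a)) := by
  simp only [extendHist, prependHist, Fin.cons_snoc_eq_snoc_cons, ← Fin.succ_last, Fin.cons_succ]

theorem extendHist_initHist (x : Euc n) (a : S.U × Euc l) :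
    S.extendHist 0 (initHist l x, a) = prependHist 0 x a.2 (initHist l (S.f x a.1 a.2)) := by
  refine Prod.ext (funext fun j => ?_) (funext fun j => ?_)
  · fin_cases j <;> rfl
  · fin_cases j; rfl

theorem extendHist_fst_zero (i : ℕ) (h : Hist n l i) (a : S.U × Euc l) :
    (S.extendHist i (h, a)).1 0 = h.1 0 := by
  simp only [extendHist]
  exact Fin.snoc_castSucc (α := fun _ => Euc n) _ _ 0

/-- Two strategies that make the same decisions after the first stage, on the histories whose state
after that stage is `y`, continue in the same way from `y`. -/
theorem pathLaw_prependHist (π ρ : S.Policy) (x y : Euc n) (w : Euc l)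
    (hπ : ∀ (i : ℕ) (h : Hist n l i), h.1 0 = y → π.1 (i + 1) (prependHist i x w h) = ρ.1 i h)
    (k i : ℕ) (h : Hist n l i) (hy : h.1 0 = y) :
    S.pathLaw π k (i + 1) (prependHist i x w h) = S.pathLaw ρ k i h := by
  induction k generalizing i with
  | zero => simp [pathLaw]
  | succ k ih =>
    refine Measure.ext_of_lintegral _ fun F hF => ?_
    rw [lintegral_pathLaw_succ _ _ _ _ _ hF, lintegral_pathLaw_succ _ _ _ _ _ hF, hπ i h hy]
    simp only [extendHist_prependHist]
    refine lintegral_congr fun u => lintegral_congr fun v => ?_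
    rw [ih _ _ ((S.extendHist_fst_zero i h (u, v)).trans hy)]

/-- The strategy that is left after a first stage with state `x` and disturbance `w`. -/
noncomputable def shift (π : S.Policy) (x : Euc n) (w : Euc l) : S.Policy :=
  ⟨fun i => (π.1 (i + 1)).comap (prependHist i x w) (measurable_prependHist i x w),
    fun _ => inferInstance⟩

/-- The path law after a first stage is the path law of the shifted strategy, started afresh. -/
theorem pathLaw_extendHist_initHist (π : S.Policy) (k : ℕ) (x : Euc n) (a : S.U × Euc l) :
    S.pathLaw π k (0 + 1) (S.extendHist 0 (initHist l x, a)) =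
      S.law (S.shift π x a.2) k (S.f x a.1 a.2) := by
  rw [extendHist_initHist, law]
  exact S.pathLaw_prependHist π _ x (S.f x a.1 a.2) a.2 (fun i h _ => rfl) k 0 _ rfl

theorem measurable_lintegral_law (π : S.Policy) (k : ℕ) (x : Euc n) (w : Euc l)
    {F : (Fin (k + 1) → S.U × Euc l) → ℝ≥0∞} (hF : Measurable F) :
    Measurable (fun u : S.U =>
      ∫⁻ ω, F (Fin.cons (u, w) ω) ∂(S.law (S.shift π x w) k (S.f x u w))) := by
  have := (S.measurable_lintegral_pathLaw_extendHist π k 0 hF).comp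
    (measurable_const.prodMk (measurable_id.prodMk measurable_const) :
      Measurable fun u : S.U => (initHist l x, (u, w)))
  simpa only [Function.comp_def, pathLaw_extendHist_initHist] using this

theorem lintegral_law_succ (π : S.Policy) (k : ℕ) (x : Euc n)
    {F : (Fin (k + 1) → S.U × Euc l) → ℝ≥0∞} (hF : Measurable F) :
    ∫⁻ ω, F ω ∂(S.law π (k + 1) x) =
      ∫⁻ u, ∫⁻ w, ∫⁻ ω, F (Fin.cons (u, w) ω) ∂(S.law (S.shift π x w) k (S.f x u w))
        ∂S.P ∂(π.1 0 (initHist l x)) := by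
  rw [law, lintegral_pathLaw_succ _ _ _ _ _ hF]
  simp only [pathLaw_extendHist_initHist]

/-- The disturbance of stage `j` is independent of the information available before it: a
functional of both is integrated by replacing the disturbance by a fresh one. -/
theorem lintegral_pathLaw_disturbance (π : S.Policy) (k i : ℕ) (h : Hist n l i) (j : Fin k)
    {F : (Fin k → S.U × Euc l) → Euc l → ℝ≥0∞}
    (hF : Measurable (Function.uncurry F))
    (hFj : ∀ ω ω' : Fin k → S.U × Euc l, (∀ a < j, ω a = ω' a) → (ω j).1 = (ω' j).1 → F ω = F ω') :
    ∫⁻ ω, F ω (ω j).2 ∂(S.pathLaw π k i h) =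
      ∫⁻ ω, ∫⁻ w, F ω w ∂S.P ∂(S.pathLaw π k i h) := by
  induction k generalizing i with
  | zero => exact j.elim0
  | succ k ih =>
    rw [lintegral_pathLaw_succ, lintegral_pathLaw_succ]
    rotate_left
    · exact hF.lintegral_prod_right'
    · exact hF.comp (measurable_id.prodMk (by fun_prop))
    refine lintegral_congr fun u => ?_
    induction j using Fin.cases with
    | zero =>
      obtain ⟨u₀, hu₀⟩ := S.nonempty_U
      let ω₀ : Fin k → S.U × Euc l := fun _ => (⟨u₀, hu₀⟩, 0)
      -- `F` depends only on the first control, so the rest of the path can be fixed arbitrarily.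
      have key : ∀ (w : Euc l) (ω : Fin k → S.U × Euc l), F (Fin.cons (u, w) ω) =
          F (Fin.cons (u, 0) ω₀) := fun w ω =>
        hFj _ _ (fun a ha => absurd ha (Fin.not_lt_zero a)) (by simp)
      simp [key]
    | succ j =>
      refine lintegral_congr fun w => ?_
      refine ih (i + 1) _ j (F := fun ω v => F (Fin.cons (u, w) ω) v) ?_ ?_
      · exact hF.comp (f := fun p : (Fin k → S.U × Euc l) × Euc l =>
          ((Fin.cons (u, w) p.1 : Fin (k + 1) → S.U × Euc l), p.2))
          (((measurable_finCons k).comp (measurable_const.prodMk measurable_fst)).prodMk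
            measurable_snd)
      · intro ω ω' h1 h2
        refine hFj _ _ (fun a ha => ?_) (by simpa using h2)
        induction a using Fin.cases with
        | zero => rfl
        | succ a => simpa using h1 a (by simpa using ha)

/-! ### Conditional value-at-risk along a path -/

theorem continuous_riskObjective {N : ℕ} (w : Fin N → Euc l) (x : Euc n) (u : Euc m) :
    Continuous (S.riskObjective w x u) := by
  unfold riskObjective; fun_prop

theorem measurable_riskObjective {N : ℕ} (w : Fin N → Euc l) :
    Measurable (fun p : Euc n × Euc m × ℝ => S.riskObjective w p.1 p.2.1 p.2.2) := by
  unfold riskObjective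
  have h : ∀ i, Measurable fun p : Euc n × Euc m × ℝ => Metric.infDist (S.f p.1 p.2.1 (w i)) S.A :=
    fun i => (Metric.continuous_infDist_pt S.A).measurable.comp (S.measurable_f.comp
      (f := fun p : Euc n × Euc m × ℝ => (p.1, p.2.1, w i)) (by fun_prop))
  have h' : ∀ i, Measurable fun p : Euc n × Euc m × ℝ =>
      max (Metric.infDist (S.f p.1 p.2.1 (w i)) S.A - p.2.2) 0 := fun i =>
    ((h i).sub (by fun_prop)).max measurable_const
  exact Measurable.add (by fun_prop) ((Finset.measurable_fun_sum _ fun i _ => h' i).div_const _)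

theorem le_riskObjective {N : ℕ} (w : Fin N → Euc l) (x : Euc n) (u : Euc m) (z : ℝ) :
    z ≤ S.riskObjective w x u z := by
  have h1 : 0 ≤ (N : ℝ) * (1 - S.α) := mul_nonneg (by positivity) (sub_pos.2 S.α_lt_one).le
  exact le_add_of_nonneg_right (div_nonneg (Finset.sum_nonneg fun i _ => le_max_right _ _) h1)

/-- As `α > 0`, the slope `1 - 1/(1-α)` of the objective near `-∞` is negative. -/
theorem neg_mul_le_riskObjective {N : ℕ} (hN : 0 < N) (w : Fin N → Euc l) (x : Euc n) (u : Euc m)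
    (z : ℝ) : -z * (S.α / (1 - S.α)) ≤ S.riskObjective w x u z := by
  have hα : 0 < 1 - S.α := sub_pos.2 S.α_lt_one
  have hN' : (0 : ℝ) < N := by exact_mod_cast hN
  have h1 : (N : ℝ) * (-z) ≤ ∑ i, max (Metric.infDist (S.f x u (w i)) S.A - z) 0 := by
    calc (N : ℝ) * (-z) = ∑ _i : Fin N, (-z) := by simp
      _ ≤ _ := Finset.sum_le_sum fun i _ => le_trans
        (by linarith [Metric.infDist_nonneg (x := S.f x u (w i)) (s := S.A)]) (le_max_left _ _)
  calc -z * (S.α / (1 - S.α)) = z + (N * (-z)) / (N * (1 - S.α)) := by field_simp; ring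
    _ ≤ _ := by unfold riskObjective; gcongr

theorem exists_forall_riskObjective_le {N : ℕ} (hN : 0 < N) (w : Fin N → Euc l) (x : Euc n)
    (u : Euc m) : ∃ z₀, ∀ z, S.riskObjective w x u z₀ ≤ S.riskObjective w x u z := by
  refine (S.continuous_riskObjective w x u).exists_forall_le ?_
  have hα : 0 < S.α / (1 - S.α) := div_pos S.α_pos (sub_pos.2 S.α_lt_one)
  rw [cocompact_eq_atBot_atTop]
  refine Tendsto.sup ?_ ?_
  · exact tendsto_atTop_mono (S.neg_mul_le_riskObjective hN w x u)
      (tendsto_neg_atBot_atTop.atTop_mul_const hα)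
  · exact tendsto_atTop_mono (S.le_riskObjective w x u) tendsto_id

/-- The conditional value-at-risk of the distance to `A` after one stage from `x` under `u`. The
infimum is restricted to rational `z`, which does not change it and makes it measurable. -/
noncomputable def stageRisk {N : ℕ} (w : Fin N → Euc l) (x : Euc n) (u : Euc m) : EReal :=
  ⨅ z : ℚ, (S.riskObjective w x u z : EReal)

theorem measurable_stageRisk {Ω : Type*} [MeasurableSpace Ω] {N : ℕ} (w : Fin N → Euc l)
    {x : Ω → Euc n} {u : Ω → Euc m} (hx : Measurable x) (hu : Measurable u) :
    Measurable (fun o => S.stageRisk w (x o) (u o)) := by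
  refine Measurable.iInf fun z => measurable_coe_real_ereal.comp ?_
  exact (S.measurable_riskObjective w).comp (f := fun o => (x o, u o, (z : ℝ)))
    (hx.prodMk (hu.prodMk measurable_const))

theorem stageRisk_le {N : ℕ} (w : Fin N → Euc l) (x : Euc n) (u : Euc m) (z : ℝ) :
    S.stageRisk w x u ≤ S.riskObjective w x u z := by
  have hc : IsClosed {z : ℝ | S.stageRisk w x u ≤ (S.riskObjective w x u z : EReal)} :=
    isClosed_le continuous_const
      (continuous_coe_real_ereal.comp (S.continuous_riskObjective w x u))
  -- The inequality holds at rational `z`, hence at all `z` by continuity.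
  have := hc.closure_subset_iff.2 (Set.range_subset_iff.2 fun q : ℚ =>
    (iInf_le (fun q : ℚ => (S.riskObjective w x u q : EReal)) q : _))
  exact this (Rat.denseRange_cast z)

theorem stageRisk_le_iff {N : ℕ} (hN : 0 < N) (w : Fin N → Euc l) (x : Euc n) (u : Euc m) :
    S.stageRisk w x u ≤ (S.δ : EReal) ↔ ∃ z, S.riskObjective w x u z ≤ S.δ := by
  constructor
  · intro h
    obtain ⟨z₀, hz₀⟩ := S.exists_forall_riskObjective_le hN w x u
    refine ⟨z₀, EReal.coe_le_coe_iff.1 (le_trans ?_ h)⟩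
    exact le_iInf fun q => EReal.coe_le_coe_iff.2 (hz₀ q)
  · rintro ⟨z, hz⟩
    exact (S.stageRisk_le w x u z).trans (EReal.coe_le_coe_iff.2 hz)

@[simp]
theorem state_zero {k : ℕ} (x : Euc n) (ω : Fin k → S.U × Euc l) : S.state x ω 0 = x := rfl

theorem state_succ {k : ℕ} (x : Euc n) (ω : Fin k → S.U × Euc l) (j : Fin k) :
    S.state x ω j.succ = S.f (S.state x ω j.castSucc) (ω j).1 (ω j).2 := by
  simp [state]

theorem state_cons_succ {k : ℕ} (x : Euc n) (a : S.U × Euc l) (ω : Fin k → S.U × Euc l)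
    (j : Fin (k + 1)) :
    S.state x (Fin.cons a ω) j.succ = S.state (S.f x a.1 a.2) ω j := by
  induction j using Fin.induction with
  | zero => rw [state_succ]; rfl
  | succ j ih => rw [state_succ, state_succ, ← Fin.succ_castSucc, ih]; rfl

theorem measurable_state {Ω : Type*} [MeasurableSpace Ω] {k : ℕ} (x : Euc n)
    (φ : Ω → Fin k → S.U × Euc l) (j : Fin (k + 1))
    (hφ : ∀ i : Fin k, i.castSucc < j → Measurable fun o => φ o i) :
    Measurable fun o => S.state x (φ o) j := by
  induction j using Fin.induction with
  | zero => exact measurable_const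
  | succ j ih =>
    simp only [state_succ]
    have h1 := ih fun i hi => hφ i (hi.trans j.castSucc_lt_succ)
    have h2 := hφ j j.castSucc_lt_succ
    exact S.measurable_f.comp (h1.prodMk ((measurable_subtype_coe.comp h2.fst).prodMk h2.snd))

theorem info_le {k : ℕ} (j : Fin k) : S.info j ≤ MeasurableSpace.pi :=
  Measurable.comap_le (by fun_prop)

theorem measurable_info_of_lt {k : ℕ} (j i : Fin k) (hi : i < j) :
    Measurable[S.info j] (fun ω : Fin k → S.U × Euc l => ω i) :=
  (measurable_pi_apply (X := fun _ : {i : Fin k // i < j} => S.U × Euc l) ⟨i, hi⟩).comp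
    (measurable_fst.comp (comap_measurable
      (fun ω : Fin k → S.U × Euc l => ((fun i : {i : Fin k // i < j} => ω i.1), (ω j).1))))

theorem measurable_info_control {k : ℕ} (j : Fin k) :
    Measurable[S.info j] (fun ω : Fin k → S.U × Euc l => ((ω j).1 : Euc m)) :=
  measurable_subtype_coe.comp (measurable_snd.comp (comap_measurable
    (fun ω : Fin k → S.U × Euc l => ((fun i : {i : Fin k // i < j} => ω i.1), (ω j).1))))

theorem measurable_info_state {k : ℕ} (x : Euc n) (j : Fin k) :
    Measurable[S.info j] (fun ω : Fin k → S.U × Euc l => S.state x ω j.castSucc) :=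
  @measurable_state _ _ _ S _ (S.info j) k x id j.castSucc
    fun i hi => S.measurable_info_of_lt j i (by simpa using hi)

theorem mem_iff_mem_of_measurableSet_info {k : ℕ} {j : Fin k} {s : Set (Fin k → S.U × Euc l)}
    (hs : MeasurableSet[S.info j] s) {ω ω' : Fin k → S.U × Euc l} (h : ∀ a < j, ω a = ω' a)
    (hj : (ω j).1 = (ω' j).1) : ω ∈ s ↔ ω' ∈ s := by
  obtain ⟨t, -, rfl⟩ := hs
  have : ((fun i : {i : Fin k // i < j} => ω i.1), (ω j).1) =
      ((fun i : {i : Fin k // i < j} => ω' i.1), (ω' j).1) :=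
    Prod.ext (funext fun i => h i.1 i.2) hj
  simp only [Set.mem_preimage, this]

/-- An `S.info j`-measurable function depends only on the stages before `j` and on the control of
stage `j`. -/
theorem eq_of_measurable_info {k : ℕ} {j : Fin k} {β : Type*} [MeasurableSpace β]
    [MeasurableSingletonClass β] {Z : (Fin k → S.U × Euc l) → β} (hZ : Measurable[S.info j] Z)
    {ω ω' : Fin k → S.U × Euc l} (h : ∀ a < j, ω a = ω' a) (hj : (ω j).1 = (ω' j).1) :
    Z ω = Z ω' :=
  (S.mem_iff_mem_of_measurableSet_info (hZ (measurableSet_singleton (Z ω'))) h hj).2 rfl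

theorem coe_add_lintegral_eq_riskObjective {N : ℕ} (hN : 0 < N) {w : Fin N → Euc l}
    (hP : S.P = empiricalMeasure w) (x : Euc n) (u : Euc m) (z : ℝ) :
    (z : EReal) + ((∫⁻ v, ENNReal.ofReal
      (max (Metric.infDist (S.f x u v) S.A - z) 0 / (1 - S.α)) ∂S.P : ℝ≥0∞) : EReal) =
      (S.riskObjective w x u z : EReal) := by
  have hα : 0 < 1 - S.α := sub_pos.2 S.α_lt_one
  have hN' : (0 : ℝ) < N := by exact_mod_cast hN
  have h0 : ∀ i, 0 ≤ max (Metric.infDist (S.f x u (w i)) S.A - z) 0 / (1 - S.α) :=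
    fun i => div_nonneg (le_max_right _ _) hα.le
  rw [hP, lintegral_empiricalMeasure, ← ENNReal.ofReal_sum_of_nonneg fun i _ => h0 i,
    ← ENNReal.ofReal_natCast, ← ENNReal.ofReal_inv_of_pos hN', ← ENNReal.ofReal_mul (by positivity),
    EReal.coe_ennreal_ofReal, max_eq_left
      (mul_nonneg (by positivity) (Finset.sum_nonneg fun i _ => h0 i)), riskObjective,
    ← Finset.sum_div, ← EReal.coe_add]
  congr 2
  field_simp

/-- Under the law of a strategy, the state and the control of stage `j` are known and the
disturbance is fresh, so that the conditional objective is the one-stage objective. -/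
theorem condCVaRObjective_ae_eq {N : ℕ} (hN : 0 < N) {w : Fin N → Euc l}
    (hP : S.P = empiricalMeasure w) (π : S.Policy) (k : ℕ) (x : Euc n) (j : Fin k)
    {Z : (Fin k → S.U × Euc l) → ℝ} (hZ : Measurable[S.info j] Z) :
    ∀ᵐ ω ∂(S.law π k x), condCVaRObjective (S.law π k x) (S.info j) S.α
      (fun ω => Metric.infDist (S.state x ω j.succ) S.A) Z ω =
      (S.riskObjective w (S.state x ω j.castSucc) (ω j).1 (Z ω) : EReal) := by
  let G : (Fin k → S.U × Euc l) → Euc l → ℝ≥0∞ := fun ω v => ENNReal.ofReal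
    (max (Metric.infDist (S.f (S.state x ω j.castSucc) (ω j).1 v) S.A - Z ω) 0 / (1 - S.α))
  have hx := S.measurable_info_state x j
  have hu := S.measurable_info_control j
  have hle := S.info_le j
  have hGm : ∀ mΩ : MeasurableSpace (Fin k → S.U × Euc l), S.info j ≤ mΩ →
      Measurable (Function.uncurry G) := by
    intro mΩ hm
    have hZ' := hZ.mono hm le_rfl
    have hx' := hx.mono hm le_rfl
    have hu' := hu.mono hm le_rfl
    have h1 : Measurable fun p : (Fin k → S.U × Euc l) × Euc l =>
        S.f (S.state x p.1 j.castSucc) (p.1 j).1 p.2 :=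
      S.measurable_f.comp ((hx'.comp measurable_fst).prodMk
        ((hu'.comp measurable_fst).prodMk measurable_snd))
    have h2 := (Metric.continuous_infDist_pt S.A).measurable.comp h1
    exact (((h2.sub (hZ'.comp measurable_fst)).max measurable_const).div_const _).ennreal_ofReal
  have hY : Measurable[S.info j] fun ω => ∫⁻ v, G ω v ∂S.P :=
    @Measurable.lintegral_prod_right' _ _ (S.info j) _ S.P _ _ (hGm (S.info j) le_rfl)
  have hcond := ae_eq_condLExp (hm := hle) (S.law π k x)
    (fun ω' => ENNReal.ofReal
      (max (Metric.infDist (S.state x ω' j.succ) S.A - Z ω') 0 / (1 - S.α))) hY ?_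
  · filter_upwards [hcond] with ω hω
    rw [condCVaRObjective, ← hω, ← S.coe_add_lintegral_eq_riskObjective hN hP]
  · intro s hs
    have hs' := hle s hs
    rw [← lintegral_indicator hs', ← lintegral_indicator hs']
    have := S.lintegral_pathLaw_disturbance π k 0 (initHist l x) j
      (F := fun ω v => s.indicator (fun ω => G ω v) ω) ?_ ?_
    · rw [law]
      refine Eq.trans (lintegral_congr fun ω => ?_) (this.symm.trans (lintegral_congr fun ω => ?_))
      · by_cases h : ω ∈ s <;> simp [h]
      · by_cases h : ω ∈ s <;> simp [h, G, state_succ]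
    · have h1 := (hGm _ hle).indicator (s := Prod.fst ⁻¹' s) (measurable_fst hs')
      convert h1 using 1
      ext p
      by_cases h : p.1 ∈ s <;> simp [Function.uncurry, h]
    · intro ω ω' h1 h2
      have e1 := S.eq_of_measurable_info hx h1 h2
      have e2 := S.eq_of_measurable_info hZ h1 h2
      have e3 := S.mem_iff_mem_of_measurableSet_info hs h1 h2
      ext v
      classical
      simp only [Set.indicator_apply, G, e1, e2, e3, h2]

/-- Feasibility is a pointwise condition on the states and the controls: at almost every path, the
one-stage constraint holds at all stages. -/
theorem feasible_iff {N : ℕ} (hN : 0 < N) {w : Fin N → Euc l}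
    (hP : S.P = empiricalMeasure w) (π : S.Policy) (k : ℕ) (x : Euc n) :
    S.Feasible π k x ↔ ∀ j : Fin k, ∀ᵐ ω ∂(S.law π k x),
      S.stageRisk w (S.state x ω j.castSucc) (ω j).1 ≤ (S.δ : EReal) := by
  refine forall_congr' fun j => ?_
  have hm : Measurable[S.info j] fun ω : Fin k → S.U × Euc l =>
      S.stageRisk w (S.state x ω j.castSucc) (ω j).1 := by
    exact @measurable_stageRisk _ _ _ S _ (S.info j) _ w _ _
      (S.measurable_info_state x j) (S.measurable_info_control j)
  have hlb : ∀ Z : (Fin k → S.U × Euc l) → ℝ, Measurable[S.info j] Z →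
      ∀ᵐ ω ∂(S.law π k x), S.stageRisk w (S.state x ω j.castSucc) (ω j).1 ≤
        condCVaRObjective (S.law π k x) (S.info j) S.α
          (fun ω => Metric.infDist (S.state x ω j.succ) S.A) Z ω := by
    intro Z hZ
    filter_upwards [S.condCVaRObjective_ae_eq hN hP π k x j hZ] with ω h
    rw [h]
    exact S.stageRisk_le _ _ _ _
  constructor
  · rintro ⟨C, hC, hδ⟩
    filter_upwards [hδ, hC.greatest _ hm fun Z hZ _ => hlb Z hZ] with ω h1 h2 using h2.trans h1
  -- The stage risk is a version of the conditional value-at-risk: constant rational `Z` suffice to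
  -- bound any other lower bound by it.
  · intro h
    refine ⟨_, ⟨hm, fun Z hZ _ => hlb Z hZ, fun C' _ hC' => ?_⟩, h⟩
    have hq : ∀ q : ℚ, ∀ᵐ ω ∂(S.law π k x),
        C' ω ≤ (S.riskObjective w (S.state x ω j.castSucc) (ω j).1 q : EReal) := fun q => by
      filter_upwards [hC' (fun _ => q) measurable_const (memLp_const _),
        S.condCVaRObjective_ae_eq hN hP π k x j (Z := fun _ => (q : ℝ)) measurable_const]
        with ω h1 h2
      exact h2 ▸ h1
    filter_upwards [ae_all_iff.2 hq] with ω h using le_iInf h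

/-! ### Dynamic programming -/

theorem totalCost_cons {k : ℕ} (x : Euc n) (a : S.U × Euc l) (ω : Fin k → S.U × Euc l) :
    S.totalCost x (Fin.cons a ω) = S.r x a.1 + S.totalCost (S.f x a.1 a.2) ω := by
  rw [totalCost, totalCost, Fin.sum_univ_succ, ← Fin.succ_last, state_cons_succ, add_assoc]
  simp only [← Fin.succ_castSucc, state_cons_succ, Fin.cons_zero, Fin.cons_succ]
  rfl

theorem measurable_totalCost {k : ℕ} (x : Euc n) :
    Measurable (fun ω : Fin k → S.U × Euc l => S.totalCost x ω) := by
  have hs : ∀ j, Measurable fun ω : Fin k → S.U × Euc l => S.state x ω j := fun j =>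
    S.measurable_state x id j fun i _ => measurable_pi_apply i
  refine Measurable.add (Finset.measurable_fun_sum _ fun j _ => ?_) (S.measurable_q.comp (hs _))
  exact S.measurable_r.comp (f := fun ω : Fin k → S.U × Euc l =>
    (S.state x ω j.castSucc, ((ω j).1 : Euc m))) ((hs _).prodMk (by fun_prop))

/-- The expected cost of a stage with control `u` that is followed by paths of laws `μ i`, according
to the disturbance `w i`, in terms of the positive and negative parts of the total cost. -/
theorem r_add_extMean_extExpect {N k : ℕ} (hN : 0 < N) (w : Fin N → Euc l) (x : Euc n) (u : S.U)
    (μ : Fin N → Measure (Fin k → S.U × Euc l)) [∀ i, IsProbabilityMeasure (μ i)] :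
    (S.r x u : EReal) + extMean (fun i =>
      extExpect (μ i) (fun ω => (S.totalCost (S.f x u (w i)) ω : EReal))) =
    if (N : ℝ≥0∞)⁻¹ * ∑ i, ∫⁻ ω, ENNReal.ofReal (S.totalCost x (Fin.cons (u, w i) ω)) ∂(μ i) = ⊤
    then ⊤ else
      (((N : ℝ≥0∞)⁻¹ * ∑ i, ∫⁻ ω, ENNReal.ofReal (S.totalCost x (Fin.cons (u, w i) ω)) ∂(μ i) :
        ℝ≥0∞) : EReal) -
      (((N : ℝ≥0∞)⁻¹ * ∑ i, ∫⁻ ω, ENNReal.ofReal (-S.totalCost x (Fin.cons (u, w i) ω)) ∂(μ i) :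
        ℝ≥0∞) : EReal) := by
  rw [← extMean_ite_sub hN, ← extMean_const_add hN]
  congr 1
  ext i
  rw [← extExpect_const_add _ _ (S.measurable_totalCost _), ← extExpect_coe]
  simp only [totalCost_cons]

theorem ae_law_succ_iff {N : ℕ} {w : Fin N → Euc l} (hP : S.P = empiricalMeasure w)
    (π : S.Policy) (k : ℕ) (x : Euc n) {p : (Fin (k + 1) → S.U × Euc l) → Prop}
    (hp : MeasurableSet {ω | p ω}) :
    (∀ᵐ ω ∂(S.law π (k + 1) x), p ω) ↔ ∀ᵐ u ∂(π.1 0 (initHist l x)), ∀ i,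
      ∀ᵐ ω ∂(S.law (S.shift π x (w i)) k (S.f x u (w i))), p (Fin.cons (u, w i) ω) := by
  let F : (Fin (k + 1) → S.U × Euc l) → ℝ≥0∞ := {ω | p ω}ᶜ.indicator 1
  have hF : Measurable F := measurable_one.indicator hp.compl
  have hFp : ∀ ω, F ω = 0 ↔ p ω := fun ω => by
    by_cases h : p ω <;> simp [F, h]
  have hc : ∀ a : S.U × Euc l, Measurable fun ω : Fin k → S.U × Euc l =>
      F (Fin.cons (α := fun _ => S.U × Euc l) a ω) :=
    fun a => hF.comp ((measurable_finCons k).comp (measurable_const.prodMk measurable_id))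
  have h1 : (∀ᵐ ω ∂(S.law π (k + 1) x), p ω) ↔ ∫⁻ ω, F ω ∂(S.law π (k + 1) x) = 0 := by
    rw [lintegral_eq_zero_iff hF]
    exact eventually_congr (Eventually.of_forall fun ω => (hFp ω).symm)
  rw [h1, S.lintegral_law_succ π k x hF, hP]
  simp only [lintegral_empiricalMeasure]
  rw [lintegral_eq_zero_iff
    ((Finset.measurable_fun_sum _ fun i _ => S.measurable_lintegral_law π k x (w i) hF).const_mul _)]
  refine eventually_congr (Eventually.of_forall fun u => ?_)
  simp only [Pi.zero_apply, mul_eq_zero, ENNReal.inv_eq_zero, ENNReal.natCast_ne_top, false_or,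
    Finset.sum_eq_zero_iff, Finset.mem_univ, true_implies]
  refine forall_congr' fun i => ?_
  rw [lintegral_eq_zero_iff (hc _)]
  exact eventually_congr (Eventually.of_forall fun ω => hFp _)

/-- Time consistency of the constraints: a strategy is feasible if and only if almost surely its
first control satisfies the one-stage constraint and its continuations are feasible. -/
theorem feasible_succ_iff {N : ℕ} (hN : 0 < N) {w : Fin N → Euc l} (hP : S.P = empiricalMeasure w)
    (π : S.Policy) (k : ℕ) (x : Euc n) :
    S.Feasible π (k + 1) x ↔ ∀ᵐ (u : S.U) ∂(π.1 0 (initHist l x)),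
      S.stageRisk w x u ≤ (S.δ : EReal) ∧
        ∀ i, S.Feasible (S.shift π x (w i)) k (S.f x u (w i)) := by
  have hm : ∀ j : Fin (k + 1), MeasurableSet {ω : Fin (k + 1) → S.U × Euc l |
      S.stageRisk w (S.state x ω j.castSucc) (ω j).1 ≤ (S.δ : EReal)} := fun j =>
    measurableSet_le (S.measurable_stageRisk w
      (S.measurable_state x id _ fun i _ => measurable_pi_apply i)
      (measurable_subtype_coe.comp (measurable_pi_apply j).fst)) measurable_const
  have : Nonempty (Fin N) := ⟨⟨0, hN⟩⟩
  simp only [S.feasible_iff hN hP, S.ae_law_succ_iff hP π k x (hm _), ← ae_all_iff]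
  refine eventually_congr (Eventually.of_forall fun u => ?_)
  rw [Fin.forall_fin_succ]
  refine and_congr ?_ ?_
  · simp
  · rw [forall_comm]
    simp only [← Fin.succ_castSucc, state_cons_succ, Fin.cons_succ, ae_all_iff]

/-- The value function, indexed by the number `k` of remaining stages. -/
noncomputable def horizonValue (k : ℕ) (x : Euc n) : EReal :=
  ⨅ (π : S.Policy) (_ : S.Feasible π k x),
    extExpect (S.law π k x) (fun ω => (S.totalCost x ω : EReal))

theorem horizonValue_le {π : S.Policy} {k : ℕ} {x : Euc n} (hπ : S.Feasible π k x) :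
    S.horizonValue k x ≤ extExpect (S.law π k x) (fun ω => (S.totalCost x ω : EReal)) :=
  iInf₂_le π hπ

theorem value_eq_horizonValue (t : ℕ) : S.value t = S.horizonValue (S.T - t) := rfl

theorem finiteBellmanRHS_le_horizonValue {N : ℕ} (hN : 0 < N) {w : Fin N → Euc l}
    (hP : S.P = empiricalMeasure w) (k : ℕ) (x : Euc n) :
    S.finiteBellmanRHS w (S.horizonValue k) x ≤ S.horizonValue (k + 1) x := by
  refine le_iInf₂ fun π hπ => ?_
  have hm := S.measurable_totalCost (k := k + 1) x
  have hm' : Measurable fun ω : Fin (k + 1) → S.U × Euc l =>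
    ENNReal.ofReal (-S.totalCost x ω) := hm.neg.ennreal_ofReal
  rw [extExpect_coe]
  split_ifs with h
  · exact le_top
  rw [S.lintegral_law_succ π k x hm.ennreal_ofReal, hP] at h ⊢
  rw [S.lintegral_law_succ π k x hm', hP]
  simp only [lintegral_empiricalMeasure] at h ⊢
  refine le_lintegral_sub_lintegral _ ((Finset.measurable_fun_sum _ fun i _ =>
    S.measurable_lintegral_law π k x (w i) hm.ennreal_ofReal).const_mul _) h ?_
  filter_upwards [(S.feasible_succ_iff hN hP π k x).1 hπ] with u ⟨hu, hfeas⟩ hfin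
  have hcost := S.r_add_extMean_extExpect hN w x u
    (fun i => S.law (S.shift π x (w i)) k (S.f x u (w i)))
  rw [if_neg hfin] at hcost
  rw [← hcost, finiteBellmanRHS_eq]
  obtain ⟨z, hz⟩ := (S.stageRisk_le_iff hN w x u).1 hu
  refine iInf₂_le_of_le (u : Euc m) u.2 <| iInf₂_le_of_le z hz ?_
  exact add_le_add_right (extMean_mono fun i => S.horizonValue_le (hfeas i)) _

theorem measurable_invFun {N : ℕ} [Nonempty (Fin N)] (p : Fin N → Euc n) :
    Measurable (Function.invFun p) := by
  refine measurable_of_measurable_on_compl_finite _ (Set.finite_range p) ?_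
  convert measurable_const (a := Classical.arbitrary (Fin N)) using 1
  ext y
  rw [Set.domRestrict_apply, Function.invFun_neg y.2]

theorem measurable_tailHist (i : ℕ) :
    Measurable (fun h : Hist n l (i + 1) => ((Fin.tail h.1, Fin.tail h.2) : Hist n l i)) := by
  unfold Fin.tail
  fun_prop

/-- The strategy that applies `u` first, and continues with `ρ y` if the next state is a point `y`
of the range of `p` (the choice elsewhere is irrelevant). -/
noncomputable def glue {N : ℕ} [Nonempty (Fin N)] (p : Fin N → Euc n) (u : S.U)
    (ρ : Euc n → S.Policy) : S.Policy :=
  ⟨fun i => match i with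
    | 0 => Kernel.const _ (Measure.dirac u)
    | i + 1 =>
      { toFun := fun h => (ρ (p (Function.invFun p (h.1 1)))).1 i (Fin.tail h.1, Fin.tail h.2)
        measurable' := by
          have h1 : Measurable fun q : Fin N × Hist n l i => (ρ (p q.1)).1 i q.2 :=
            measurable_from_prod_countable_right fun j => ((ρ (p j)).1 i).measurable
          exact h1.comp (((measurable_invFun p).comp (by fun_prop)).prodMk
            (measurable_tailHist i)) },
    fun i => match i with
    | 0 => (inferInstance : IsMarkovKernel (Kernel.const (Hist n l 0) (Measure.dirac u)))
    | i + 1 => ⟨fun h => ((ρ (p (Function.invFun p (h.1 1)))).2 i).isProbabilityMeasure _⟩⟩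

/-- After a transition to `p j`, the pasted strategy decides as `ρ (p j)` does. -/
theorem glue_succ_prependHist {N : ℕ} [Nonempty (Fin N)] (p : Fin N → Euc n) (u : S.U)
    (ρ : Euc n → S.Policy) (x : Euc n) (w : Euc l) (j : Fin N) (i : ℕ) (h : Hist n l i)
    (hj : h.1 0 = p j) :
    (S.glue p u ρ).1 (i + 1) (prependHist i x w h) = (ρ (p j)).1 i h := by
  change (ρ (p (Function.invFun p (h.1 0)))).1 i h = _
  have hinv : p (Function.invFun p (p j)) = p j := Function.invFun_eq ⟨j, rfl⟩
  rw [hj, hinv]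

theorem law_shift_glue {N : ℕ} [Nonempty (Fin N)] (w : Fin N → Euc l) (x : Euc n) (u : S.U)
    (ρ : Euc n → S.Policy) (k : ℕ) (j : Fin N) :
    S.law (S.shift (S.glue (fun i => S.f x u (w i)) u ρ) x (w j)) k (S.f x u (w j)) =
      S.law (ρ (S.f x u (w j))) k (S.f x u (w j)) := by
  have h1 := S.pathLaw_extendHist_initHist (S.glue (fun i => S.f x u (w i)) u ρ) k x (u, w j)
  rw [← h1, extendHist_initHist]
  exact S.pathLaw_prependHist _ _ x (S.f x u (w j)) (w j)
    (S.glue_succ_prependHist (fun i => S.f x u (w i)) u ρ x (w j) j) k 0 _ rfl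

/-- A control that satisfies the one-stage constraint, followed by strategies that are feasible from
the next states, yields a feasible strategy, whose cost bounds the value from above. -/
theorem horizonValue_succ_le_of_feasible {N : ℕ} (hN : 0 < N) {w : Fin N → Euc l}
    (hP : S.P = empiricalMeasure w) (k : ℕ) (x : Euc n) (u : S.U)
    (hu : S.stageRisk w x u ≤ (S.δ : EReal)) (ρ : Euc n → S.Policy)
    (hρ : ∀ i, S.Feasible (ρ (S.f x u (w i))) k (S.f x u (w i))) :
    S.horizonValue (k + 1) x ≤ (S.r x u : EReal) + extMean (fun i =>
      extExpect (S.law (ρ (S.f x u (w i))) k (S.f x u (w i)))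
        (fun ω => (S.totalCost (S.f x u (w i)) ω : EReal))) := by
  have : Nonempty (Fin N) := ⟨⟨0, hN⟩⟩
  let π := S.glue (fun i => S.f x u (w i)) u ρ
  have hπ0 : π.1 0 (initHist l x) = Measure.dirac u := rfl
  have hlaw := S.law_shift_glue w x u ρ k
  have hfeas : S.Feasible π (k + 1) x := by
    rw [S.feasible_succ_iff hN hP, hπ0, ae_dirac_eq, eventually_pure]
    refine ⟨hu, fun i => ?_⟩
    have := hρ i
    simp only [Feasible] at this ⊢
    rwa [hlaw i]
  refine (S.horizonValue_le hfeas).trans (le_of_eq ?_)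
  have hm := S.measurable_totalCost (k := k + 1) x
  have hm' : Measurable fun ω : Fin (k + 1) → S.U × Euc l =>
    ENNReal.ofReal (-S.totalCost x ω) := hm.neg.ennreal_ofReal
  rw [S.r_add_extMean_extExpect hN, extExpect_coe, S.lintegral_law_succ π k x hm.ennreal_ofReal,
    S.lintegral_law_succ π k x hm', hP, hπ0, lintegral_dirac, lintegral_dirac,
    lintegral_empiricalMeasure, lintegral_empiricalMeasure]
  simp only [π, hlaw]

instance : Nonempty S.Policy := by
  obtain ⟨u, hu⟩ := S.nonempty_U
  exact ⟨⟨fun i => Kernel.const _ (Measure.dirac ⟨u, hu⟩), fun i => inferInstance⟩⟩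

/-- The hypothesis provides a feasible strategy; the value may be `-∞`. -/
theorem exists_seq_tendsto_horizonValue (k : ℕ) (y : Euc n) (hy : S.horizonValue k y ≠ ⊤) :
    ∃ ρ : ℕ → S.Policy, (∀ a, S.Feasible (ρ a) k y) ∧
      Tendsto (fun a => extExpect (S.law (ρ a) k y) (fun ω => (S.totalCost y ω : EReal))) atTop
        (𝓝 (S.horizonValue k y)) := by
  let s := (fun π => extExpect (S.law π k y) (fun ω => (S.totalCost y ω : EReal))) ''
    {π | S.Feasible π k y}
  have hs : S.horizonValue k y = sInf s := by
    rw [sInf_image]; rfl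
  have hne : s.Nonempty := by
    by_contra h
    rw [Set.not_nonempty_iff_eq_empty.1 h, sInf_empty] at hs
    exact hy hs
  obtain ⟨a, -, ha, has⟩ := exists_seq_tendsto_sInf hne (OrderBot.bddBelow s)
  choose ρ hρ hρa using has
  refine ⟨ρ, hρ, ?_⟩
  simpa only [hs, hρa] using ha

theorem horizonValue_le_finiteBellmanRHS {N : ℕ} (hN : 0 < N) {w : Fin N → Euc l}
    (hP : S.P = empiricalMeasure w) (k : ℕ) (x : Euc n) :
    S.horizonValue (k + 1) x ≤ S.finiteBellmanRHS w (S.horizonValue k) x := by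
  rw [finiteBellmanRHS_eq]
  refine le_iInf₂ fun u hu => le_iInf₂ fun z hz => ?_
  by_cases htop : ∃ i, S.horizonValue k (S.f x u (w i)) = ⊤
  · rw [extMean, if_pos htop]
    simp
  push Not at htop
  choose! ρ hρ hlim using S.exists_seq_tendsto_horizonValue k
  have hmean := tendsto_extMean htop fun i => hlim _ (htop i)
  have hsum := (EReal.continuousAt_add (p := ((S.r x u : EReal), extMean fun i =>
    S.horizonValue k (S.f x u (w i)))) (Or.inl (EReal.coe_ne_top _))
    (Or.inl (EReal.coe_ne_bot _))).tendsto.comp (tendsto_const_nhds.prodMk_nhds hmean)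
  refine ge_of_tendsto' hsum fun a => ?_
  exact S.horizonValue_succ_le_of_feasible hN hP k x ⟨u, hu⟩
    ((S.stageRisk_le_iff hN w x u).2 ⟨z, hz⟩) (fun y => ρ y a) fun i => hρ _ (htop i) a

theorem horizonValue_zero (x : Euc n) : S.horizonValue 0 x = (S.q x : EReal) := by
  have hcost : ∀ π : S.Policy, extExpect (S.law π 0 x)
      (fun ω => (S.totalCost x ω : EReal)) = (S.q x : EReal) := fun π => by
    have h : ∀ ω : Fin 0 → S.U × Euc l, S.totalCost x ω = S.q x := fun ω => by
      simp [totalCost]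
    simp only [h]
    rw [extExpect_coe, lintegral_const, lintegral_const, measure_univ, mul_one, mul_one,
      if_neg ENNReal.ofReal_ne_top]
    exact (EReal.coe_real_ereal_eq_coe_toNNReal_sub_coe_toNNReal _).symm
  have hfeas : ∀ π : S.Policy, S.Feasible π 0 x := fun π j => j.elim0
  simp only [horizonValue, hcost, hfeas, iInf_pos, ciInf_const]

end SafeControlProblem

theorem theorem2 {n m l : ℕ} (S : SafeControlProblem n m l) (N : ℕ) (hN : 0 < N)
    (w : Fin N → Euc l) (hP : S.P = empiricalMeasure w) :
    -- the two Bellman equations are equivalent, for every candidate function at every stage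
    (∀ v : ℕ → Euc n → EReal, ∀ t < S.T, ∀ x : Euc n,
      (v t x = S.bellmanRHS (v (t + 1)) x ↔ v t x = S.finiteBellmanRHS w (v (t + 1)) x)) ∧
    -- the value function satisfies the deterministic Bellman equation and its terminal condition
    (∀ t < S.T, ∀ x : Euc n, S.value t x = S.finiteBellmanRHS w (S.value (t + 1)) x) ∧
    (∀ x : Euc n, S.value S.T x = (S.q x : EReal)) := by
  refine ⟨fun v t _ x => ?_, fun t ht x => ?_, fun x => ?_⟩
  · rw [S.bellmanRHS_eq hN hP, S.finiteBellmanRHS_eq]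
  · rw [S.value_eq_horizonValue, S.value_eq_horizonValue,
      show S.T - t = S.T - (t + 1) + 1 by omega]
    exact le_antisymm (S.horizonValue_le_finiteBellmanRHS hN hP _ x)
      (S.finiteBellmanRHS_le_horizonValue hN hP _ x)
  · rw [S.value_eq_horizonValue, Nat.sub_self, S.horizonValue_zero]
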